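/- Let $t_1$ and $t_2$ be two distinct real numbers, let $0\le r_1<r_2<1$, and let $\eta$ be the normalised Lebesgue measure on $[r_1,r_2]$. Let $\mathcal{A}^*=\bigcup_{n\ge 1}\{1,2\}^n$ be the set of non-empty finite words over $\{1,2\}$, and let $\mathbf{r}=(r_{\mathbf a})_{\mathbf a\in\mathcal{A}^*}$ be a family of independent random variables, each with law $\eta$. For each $\mathbf r$ define $\Pi_{\mathbf r}:\{1,2\}^{\mathbb N}\to\mathbb R$ by $$\Pi_{\mathbf r}(\mathbf b):=\sum_{k=1}^{\infty}t_{b_k}\prod_{j=1}^{k-1}r_{b_1\ldots b_j}.$$ Assume that $$\log 2>-\int\log r\,d\eta(r)=-\frac{1}{r_2-r_1}\int_{r_1}^{r_2}\log r\,dr.$$ Then for every $\mathbf b\in\{1,2\}^{\mathbb N}$, for almost every $\mathbf r$ (with respect to the product measure $\prod_{\mathbf a\in\mathcal{A}^*}\eta$), the set $$\left\{x\in\mathbb R:\ |x-\Pi_{\mathbf r}(a_1\ldots a_m\mathbf b)|\le\frac{1}{2^m\cdot m}\ \text{ for infinitely many } a_1\ldots a_m\in\mathcal{A}^*\right\}$$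 has positive Lebesgue measure. -/

import Mathlib

open MeasureTheory ProbabilityTheory

noncomputable section

namespace RandomIFS

/-- Non-empty finite words over a two-letter alphabet. The letters `1` and `2` are represented by
`0` and `1` in `Fin 2`. -/
abbrev Word : Type := {a : List (Fin 2) // a ≠ []}

/-- The word `b₁ … b_{j+1}` formed by the first `j + 1` letters of the infinite sequence `b`. -/
def initialWord (b : Stream' (Fin 2)) (j : ℕ) : Word :=
  ⟨b.take (j + 1), fun h => by simpa using congrArg List.length h⟩

/-- The normalised Lebesgue measure on the interval `[r₁, r₂]`. -/
def uniformLaw (r₁ r₂ : ℝ) : Measure ℝ := volume[|Set.Icc r₁ r₂]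

/-- The law of a family `(r_a)`, indexed by the non-empty finite words, of independent random
variables, each distributed according to the normalised Lebesgue measure on `[r₁, r₂]`. -/
def ratioLaw (r₁ r₂ : ℝ) : Measure (Word → ℝ) :=
  Measure.infinitePi fun _ : Word => uniformLaw r₁ r₂

theorem isProbabilityMeasure_uniformLaw {r₁ r₂ : ℝ} (h : r₁ < r₂) :
    IsProbabilityMeasure (uniformLaw r₁ r₂) :=
  cond_isProbabilityMeasure_of_finite (by simp [h]) (by simp)

theorem isProbabilityMeasure_ratioLaw {r₁ r₂ : ℝ} (h : r₁ < r₂) :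
    IsProbabilityMeasure (ratioLaw r₁ r₂) := by
  have := isProbabilityMeasure_uniformLaw h
  unfold ratioLaw
  infer_instance

/-- The projection `Π_r(b) = ∑_{k ≥ 1} t_{b_k} ∏_{j=1}^{k-1} r_{b₁…b_j}`
(here both indices start at `0`). -/
def proj (t : Fin 2 → ℝ) (r : Word → ℝ) (b : Stream' (Fin 2)) : ℝ :=
  ∑' k : ℕ, t (b.get k) * ∏ j ∈ Finset.range k, r (initialWord b j)

/-- The set of real `x` such that `|x - Π_r(a₁…a_m b)| ≤ 1 / (2 ^ m * m)` for infinitely many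
words `a₁…a_m`, where `m ≥ 1` is the length of the word. -/
def limsupSet (t : Fin 2 → ℝ) (r : Word → ℝ) (b : Stream' (Fin 2)) : Set ℝ :=
  {x : ℝ | {a : Word |
    |x - proj t r (a.1 ++ₛ b)| ≤ 1 / ((2 : ℝ) ^ a.1.length * (a.1.length : ℝ))}.Infinite}

end RandomIFS

end

/-!
The radii `1 / (2 ^ m * m)` add up, over the `2 ^ m` words of length `m`, to the divergent series
`∑ 2 / m`, so the limsup set has positive measure as soon as the centres `Π_r(a b)` do not
cluster too much at scale `2 ^ (-m)`.

Deterministic part. Suppose that at infinitely many levels `n`, carrying a divergent part of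
`∑ 1 / n`, at least half of the `2 ^ n` centres are `s / 2 ^ n`-separated. A ball of level `m` then
contains about its expected share of the balls of each level `n ≥ m`, so the unions of balls are
quasi-independent on average, and a second moment argument bounds the measure of the limsup set
below (`volume_infinitely_often_pos`).

Transversality. If `u` and `w` first differ right after a common prefix of length `k`, then
`Π_r(u) - Π_r(w)` is the product `P_k` of the ratios along the common prefix times an expression
that is affine in each of the two ratios just below the branching point. Either one of the two slopes is bounded away from
zero, or both are small and the constant term `t_i - t_j` dominates; so, on the event `P_k ≥ ρ`, the
projections are within `δ` with probability `O(δ / ρ)` (`ratioLaw_close_le`).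

Separation. Take `γ` strictly between `-∫ log r dη(r)` and `log 2`. By the strong law of large
numbers, up to small probability `P_k ≥ c exp (-γ k)` for all `k`. A word of length `n` has at most
`2 ^ (n - k)` companions branching off at `k`, so the probability that one of its companions comes
within `s / 2 ^ n` is at most a constant times `s ∑ (exp γ / 2) ^ k`, which is small with `s`,
uniformly in `n` (`exists_forall_ratioLaw_exists_close_le`). Hence, for each `n`, at least half of
the words of length `n` are isolated with probability close to one, and with probability close to
one the levels at which this happens carry a divergent part of the harmonic series
(`measure_tsum_indicator_ne_top_le`). The exceptional probability is arbitrarily small.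
-/

noncomputable section

namespace RandomIFS

open Set Filter Topology

/-! ### Quasi-independence of separated balls -/

theorem measureReal_biUnion_Icc {C : Finset ℝ} {δ ρ : ℝ} (hρ : 0 ≤ ρ) (hδ : 2 * ρ ≤ δ)
    (hC : ∀ p ∈ C, ∀ q ∈ C, p ≠ q → δ < |p - q|) :
    volume.real (⋃ p ∈ C, Icc (p - ρ) (p + ρ)) = C.card * (2 * ρ) := by
  rw [measureReal_biUnion_finset (h := fun _ _ => measure_Icc_lt_top.ne)]
  · have : ∀ p : ℝ, volume.real (Icc (p - ρ) (p + ρ)) = 2 * ρ := fun p => by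
      rw [Real.volume_real_Icc_of_le (by linarith)]; ring
    simp [this]
  · intro p hp q hq hpq
    refine Set.disjoint_left.2 fun x hx hx' => ?_
    have h := hC p hp q hq hpq
    simp only [mem_Icc] at hx hx'
    have : |p - q| ≤ 2 * ρ := abs_le.2 ⟨by linarith, by linarith⟩
    linarith
  · exact fun p _ => measurableSet_Icc

/-- The balls of radius `δ / (2 * N)` about a `δ`-separated set take up at most the share `1 / N` of
an interval, up to an edge effect: they fill the fraction `1 / N` of the disjoint balls of radius
`δ / 2` about the same points. -/
theorem measureReal_biUnion_Icc_inter_Icc_le {C : Finset ℝ} {δ : ℝ} (hδ : 0 < δ)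
    (hC : ∀ p ∈ C, ∀ q ∈ C, p ≠ q → δ < |p - q|) {N : ℕ} (hN : 1 ≤ N) (p : ℝ) {σ : ℝ}
    (hσ : 0 ≤ σ) :
    volume.real ((⋃ q ∈ C, Icc (q - δ / (2 * N)) (q + δ / (2 * N))) ∩ Icc (p - σ) (p + σ))
      ≤ (2 * σ + 2 * δ) / N := by
  have hN' : (1 : ℝ) ≤ N := by exact_mod_cast hN
  set ρ : ℝ := δ / (2 * N) with hρdef
  have hρ : 0 ≤ ρ := by positivity
  have h2ρ : 2 * ρ = δ / N := by rw [hρdef]; field_simp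
  have hρδ : 2 * ρ ≤ δ := by rw [h2ρ]; exact div_le_self hδ.le hN'
  -- Only the points of `C` within `σ + ρ` of `p` have a ball meeting the interval about `p`.
  set C' := C.filter fun q => |q - p| ≤ σ + ρ with hC'
  have hsep : ∀ x ∈ C', ∀ y ∈ C', x ≠ y → δ < |x - y| := fun x hx y hy =>
    hC x (Finset.mem_filter.1 hx).1 y (Finset.mem_filter.1 hy).1
  have hfin : ∀ (D : Finset ℝ) (τ : ℝ), volume (⋃ q ∈ D, Icc (q - τ) (q + τ)) ≠ ⊤ := fun D τ =>
    ((measure_biUnion_finset_le _ _).trans_lt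
      (ENNReal.sum_lt_top.2 fun q _ => measure_Icc_lt_top)).ne
  have h1 : volume.real ((⋃ q ∈ C, Icc (q - ρ) (q + ρ)) ∩ Icc (p - σ) (p + σ))
      ≤ C'.card * (2 * ρ) := by
    rw [← measureReal_biUnion_Icc hρ hρδ hsep]
    refine measureReal_mono ?_ (hfin _ _)
    rintro x ⟨hx, hx'⟩
    simp only [mem_iUnion, exists_prop, mem_Icc] at hx hx' ⊢
    obtain ⟨q, hq, hqx⟩ := hx
    exact ⟨q, Finset.mem_filter.2 ⟨hq, abs_le.2 ⟨by linarith, by linarith⟩⟩, hqx⟩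
  have h2 : C'.card * δ ≤ 2 * σ + 2 * δ := by
    have h3 := measureReal_biUnion_Icc (half_pos hδ).le (le_of_eq (by ring)) hsep
    have h4 : volume.real (⋃ q ∈ C', Icc (q - δ / 2) (q + δ / 2))
        ≤ volume.real (Icc (p - (σ + ρ + δ / 2)) (p + (σ + ρ + δ / 2))) := by
      refine measureReal_mono ?_ measure_Icc_lt_top.ne
      refine iUnion₂_subset fun q hq => ?_
      have := abs_le.1 (Finset.mem_filter.1 hq).2
      exact Icc_subset_Icc (by linarith) (by linarith)
    rw [h3, Real.volume_real_Icc_of_le (by linarith)] at h4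
    linarith
  refine h1.trans ?_
  rw [h2ρ, ← mul_div_assoc]
  gcongr

/-- A second moment lower bound for the measure of a finite union. It is the integral of the
pointwise inequality `2 c f ≤ f ^ 2 + c ^ 2`, where `f` counts the sets containing a point. -/
theorem two_mul_sum_sub_sum_le_measureReal_biUnion {α ι : Type*} [MeasurableSpace α]
    {μ : Measure α} (F : Finset ι) {E : ι → Set α} (hE : ∀ i ∈ F, MeasurableSet (E i))
    (hfin : ∀ i ∈ F, μ (E i) ≠ ⊤) (c : ℝ) :
    2 * c * ∑ i ∈ F, μ.real (E i) - ∑ i ∈ F, ∑ j ∈ F, μ.real (E i ∩ E j)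
      ≤ c ^ 2 * μ.real (⋃ i ∈ F, E i) := by
  classical
  have hUm : MeasurableSet (⋃ i ∈ F, E i) := F.measurableSet_biUnion hE
  have hUf : μ (⋃ i ∈ F, E i) ≠ ⊤ :=
    ((measure_biUnion_finset_le _ _).trans_lt
      (ENNReal.sum_lt_top.2 fun q hq => (hfin q hq).lt_top)).ne
  have hint : ∀ s : Set α, MeasurableSet s → μ s ≠ ⊤ →
      Integrable (s.indicator (fun _ => (1 : ℝ))) μ := fun s hs hs' =>
    (integrable_indicator_iff hs).2 (integrableOn_const hs')
  have hintegral : ∀ s : Set α, MeasurableSet s →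
      ∫ x, s.indicator (fun _ => (1 : ℝ)) x ∂μ = μ.real s := fun s hs => by
    rw [integral_indicator hs]; simp
  have hEE : ∀ i ∈ F, ∀ j ∈ F, Integrable ((E i ∩ E j).indicator (fun _ => (1 : ℝ))) μ :=
    fun i hi j hj => hint _ ((hE i hi).inter (hE j hj))
      (measure_ne_top_of_subset inter_subset_left (hfin i hi))
  have hE1 : ∀ i ∈ F, Integrable ((E i).indicator (fun _ => (1 : ℝ))) μ :=
    fun i hi => hint _ (hE i hi) (hfin i hi)
  have key : ∫ x, (2 * c * ∑ i ∈ F, (E i).indicator (fun _ => (1 : ℝ)) x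
      - ∑ i ∈ F, ∑ j ∈ F, (E i ∩ E j).indicator (fun _ => (1 : ℝ)) x) ∂μ
      ≤ ∫ x, c ^ 2 * (⋃ i ∈ F, E i).indicator (fun _ => (1 : ℝ)) x ∂μ := by
    refine integral_mono ?_ ((hint _ hUm hUf).const_mul _) fun x => ?_
    · exact ((integrable_finsetSum _ hE1).const_mul _).sub
        (integrable_finsetSum _ fun i hi => integrable_finsetSum _ (hEE i hi))
    · have hprod : ∑ i ∈ F, ∑ j ∈ F, (E i ∩ E j).indicator (fun _ => (1 : ℝ)) x
          = (∑ i ∈ F, (E i).indicator (fun _ => (1 : ℝ)) x) ^ 2 := by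
        rw [sq, Finset.sum_mul_sum]
        refine Finset.sum_congr rfl fun i _ => Finset.sum_congr rfl fun j _ => ?_
        simp only [indicator, mem_inter_iff]
        split_ifs <;> simp_all
      simp only [hprod]
      by_cases hx : x ∈ ⋃ i ∈ F, E i
      · rw [indicator_of_mem hx]
        nlinarith [sq_nonneg ((∑ i ∈ F, (E i).indicator (fun _ => (1 : ℝ)) x) - c)]
      · have : ∀ i ∈ F, (E i).indicator (fun _ => (1 : ℝ)) x = 0 := fun i hi =>
          indicator_of_notMem (fun h => hx (mem_biUnion (Finset.mem_coe.2 hi) h)) _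
        rw [Finset.sum_eq_zero this, indicator_of_notMem hx]
        simp
  rw [integral_const_mul, hintegral _ hUm, integral_sub, integral_const_mul,
    integral_finsetSum _ hE1, integral_finsetSum] at key
  · refine le_trans (le_of_eq ?_) key
    congr 1
    · rw [Finset.sum_congr rfl fun i hi => (hintegral _ (hE i hi)).symm]
    · refine Finset.sum_congr rfl fun i hi => ?_
      rw [integral_finsetSum _ (hEE i hi)]
      exact Finset.sum_congr rfl fun j hj => (hintegral _ ((hE i hi).inter (hE j hj))).symm
  · exact fun i hi => integrable_finsetSum _ (hEE i hi)
  · exact (integrable_finsetSum _ hE1).const_mul _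
  · exact integrable_finsetSum _ fun i hi => integrable_finsetSum _ (hEE i hi)

theorem sum_filter_le_half_pow_sub_le (F : Finset ℕ) (n : ℕ) :
    ∑ m ∈ F with m ≤ n, (1 / 2 : ℝ) ^ (n - m) ≤ 2 := by
  have h : ∑ m ∈ F with m ≤ n, (1 / 2 : ℝ) ^ (n - m)
      ≤ ∑ m ∈ Finset.range (n + 1), (1 / 2 : ℝ) ^ (n - m) := by
    refine Finset.sum_le_sum_of_subset_of_nonneg (fun m hm => ?_) fun _ _ _ => by positivity
    have := (Finset.mem_filter.1 hm).2
    exact Finset.mem_range.2 (by omega)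
  refine h.trans ?_
  have := Finset.sum_range_reflect (fun m => (1 / 2 : ℝ) ^ m) (n + 1)
  simp only [Nat.add_sub_cancel] at this
  rw [this]
  exact sum_geometric_two_le _

/-- The separated balls of radius `s / (2 ^ n * 2 n)` are quasi-independent on average over the
scales `n ∈ F`, so their union has measure bounded below in terms of `s` alone. -/
theorem div_le_measureReal_biUnion_biUnion_Icc {s : ℝ} (hs : 0 < s) {C : ℕ → Finset ℝ}
    {F : Finset ℕ} (hF : ∀ n ∈ F, 1 ≤ n) (hS : 1 ≤ ∑ n ∈ F, (1 / n : ℝ))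
    (hcard : ∀ n ∈ F, (2 : ℝ) ^ n / 2 ≤ (C n).card) (hcard' : ∀ n ∈ F, ((C n).card : ℝ) ≤ 2 ^ n)
    (hsep : ∀ n ∈ F, ∀ p ∈ C n, ∀ q ∈ C n, p ≠ q → s / 2 ^ n < |p - q|) :
    s / 36 ≤ volume.real (⋃ n ∈ F, ⋃ p ∈ C n,
      Icc (p - s / 2 ^ n / (2 * n)) (p + s / 2 ^ n / (2 * n))) := by
  set E : ℕ → Set ℝ := fun n => ⋃ p ∈ C n,
    Icc (p - s / 2 ^ n / (2 * n)) (p + s / 2 ^ n / (2 * n)) with hEdef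
  set S := ∑ n ∈ F, (1 / n : ℝ) with hSdef
  have hpos : ∀ n ∈ F, (1 : ℝ) ≤ n := fun n hn => by exact_mod_cast hF n hn
  have hEm : ∀ n, MeasurableSet (E n) := fun n =>
    (C n).measurableSet_biUnion fun _ _ => measurableSet_Icc
  have hEf : ∀ n, volume (E n) ≠ ⊤ := fun n =>
    ((measure_biUnion_finset_le _ _).trans_lt
      (ENNReal.sum_lt_top.2 fun q _ => measure_Icc_lt_top)).ne
  have hvol : ∀ n ∈ F, volume.real (E n) = (C n).card * (s / 2 ^ n / n) := fun n hn => by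
    have := hpos n hn
    have h2 : 2 * (s / 2 ^ n / (2 * n)) = s / 2 ^ n / n := by field_simp
    rw [hEdef, measureReal_biUnion_Icc (by positivity) _ (hsep n hn), h2]
    rw [h2]
    exact div_le_self (by positivity) this
  have hlow : s * S / 2 ≤ ∑ n ∈ F, volume.real (E n) := by
    rw [hSdef, Finset.mul_sum, Finset.sum_div]
    refine Finset.sum_le_sum fun n hn => ?_
    have := hpos n hn
    rw [hvol n hn]
    calc s * (1 / n) / 2 = 2 ^ n / 2 * (s / 2 ^ n / n) := by field_simp
      _ ≤ _ := by gcongr; exact hcard n hn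
  -- For `m ≤ n`, each ball of level `m` meets about the expected share of the balls of level `n`.
  have hpair : ∀ n ∈ F, ∀ m ∈ F, m ≤ n →
      volume.real (E n ∩ E m) ≤ s * (1 / n * (1 / m)) + 2 * s * (1 / n * (1 / 2) ^ (n - m)) := by
    intro n hn m hm hmn
    have h1n := hpos n hn
    have h1m := hpos m hm
    have hsub : E n ∩ E m = ⋃ p ∈ C m,
        (E n ∩ Icc (p - s / 2 ^ m / (2 * m)) (p + s / 2 ^ m / (2 * m))) := by
      rw [hEdef]; simp only [inter_iUnion]
    rw [hsub]
    refine (measureReal_biUnion_finset_le _ _).trans ?_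
    calc ∑ p ∈ C m, volume.real (E n ∩ Icc (p - s / 2 ^ m / (2 * m)) (p + s / 2 ^ m / (2 * m)))
        ≤ ∑ p ∈ C m, (2 * (s / 2 ^ m / (2 * m)) + 2 * (s / 2 ^ n)) / n :=
          Finset.sum_le_sum fun p _ => measureReal_biUnion_Icc_inter_Icc_le (by positivity)
            (hsep n hn) (hF n hn) p (by positivity)
      _ = (C m).card * ((2 * (s / 2 ^ m / (2 * m)) + 2 * (s / 2 ^ n)) / n) := by simp
      _ ≤ 2 ^ m * ((2 * (s / 2 ^ m / (2 * m)) + 2 * (s / 2 ^ n)) / n) := by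
          gcongr; exact hcard' m hm
      _ = _ := by
          obtain ⟨d, rfl⟩ := Nat.exists_eq_add_of_le hmn
          rw [Nat.add_sub_cancel_left, pow_add, div_pow, one_pow]
          field_simp
  have hbound : ∀ n ∈ F, ∀ m ∈ F, volume.real (E n ∩ E m) ≤ s * (1 / n * (1 / m))
      + (if m ≤ n then 2 * s * (1 / n * (1 / 2) ^ (n - m)) else 0)
      + (if n ≤ m then 2 * s * (1 / m * (1 / 2) ^ (m - n)) else 0) := by
    intro n hn m hm
    rcases le_total m n with h | h
    · refine (hpair n hn m hm h).trans ?_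
      rw [if_pos h]
      refine le_add_of_nonneg_right ?_
      split_ifs <;> positivity
    · rw [inter_comm]
      refine (hpair m hm n hn h).trans ?_
      rw [if_pos h, mul_comm (1 / (m : ℝ)) (1 / n)]
      have : 0 ≤ (if m ≤ n then 2 * s * (1 / n * (1 / 2) ^ (n - m)) else 0 : ℝ) := by
        split_ifs <;> positivity
      linarith
  have hgeo : ∑ n ∈ F, ∑ m ∈ F, (if m ≤ n then 2 * s * (1 / n * (1 / 2) ^ (n - m)) else 0 : ℝ)
      ≤ 4 * s * S := by
    rw [hSdef, Finset.mul_sum]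
    refine Finset.sum_le_sum fun n hn => ?_
    rw [← Finset.sum_filter, ← Finset.mul_sum, ← Finset.mul_sum]
    have := sum_filter_le_half_pow_sub_le F n
    calc 2 * s * (1 / n * ∑ m ∈ F with m ≤ n, (1 / 2 : ℝ) ^ (n - m))
        ≤ 2 * s * (1 / n * 2) := by gcongr
      _ = _ := by ring
  have hup : ∑ n ∈ F, ∑ m ∈ F, volume.real (E n ∩ E m) ≤ 9 * s * S ^ 2 := by
    calc ∑ n ∈ F, ∑ m ∈ F, volume.real (E n ∩ E m)
        ≤ _ := Finset.sum_le_sum fun n hn => Finset.sum_le_sum fun m hm => hbound n hn m hm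
      _ = s * S ^ 2 +
          ∑ n ∈ F, ∑ m ∈ F, (if m ≤ n then 2 * s * (1 / n * (1 / 2) ^ (n - m)) else 0 : ℝ)
          + ∑ m ∈ F, ∑ n ∈ F, (if n ≤ m then 2 * s * (1 / m * (1 / 2) ^ (m - n)) else 0 : ℝ) := by
          simp only [Finset.sum_add_distrib]
          rw [Finset.sum_comm (f := fun n m : ℕ => (if n ≤ m then
            2 * s * (1 / (m : ℝ) * (1 / 2) ^ (m - n)) else 0 : ℝ))]
          rw [hSdef, sq, Finset.sum_mul_sum]
          simp only [Finset.mul_sum]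
      _ ≤ s * S ^ 2 + 4 * s * S + 4 * s * S := by gcongr
      _ ≤ 9 * s * S ^ 2 := by
          nlinarith [mul_nonneg hs.le (mul_nonneg (by linarith : 0 ≤ S) (sub_nonneg.2 hS))]
  -- With first moment at least `s S / 2` and second moment at most `9 s S ^ 2`, the bound
  -- is best at the quotient `18 S` of the two.
  have hmain := two_mul_sum_sub_sum_le_measureReal_biUnion (μ := volume) F
    (fun i _ => hEm i) (fun i _ => hEf i) (18 * S)
  have h1 : 9 * s * S ^ 2 ≤ (18 * S) ^ 2 * volume.real (⋃ n ∈ F, E n) := by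
    refine le_trans ?_ hmain
    have := mul_le_mul_of_nonneg_left hlow (by linarith : 0 ≤ 2 * (18 * S))
    nlinarith
  have hS2 : 0 < S ^ 2 := by positivity
  have h2 : S ^ 2 * (9 * s) ≤ S ^ 2 * (324 * volume.real (⋃ n ∈ F, E n)) := by linarith
  have := le_of_mul_le_mul_left h2 hS2
  linarith

/-- If for infinitely many scales `n`, carrying a divergent part of the harmonic series, there are
at least `2 ^ n / 2` points that are `s / 2 ^ n`-separated, then the points approximated
infinitely often at distance comparable to `1 / (2 ^ n * n)` form a set of positive measure. -/
theorem volume_infinitely_often_pos {s R : ℝ} (hs : 0 < s) {C : ℕ → Finset ℝ} {I : Set ℕ}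
    (hI : ∀ n ∈ I, 1 ≤ n) (hdiv : ¬ Summable (I.indicator fun n : ℕ => (1 / n : ℝ)))
    (hcard : ∀ n ∈ I, (2 : ℝ) ^ n / 2 ≤ (C n).card) (hcard' : ∀ n ∈ I, ((C n).card : ℝ) ≤ 2 ^ n)
    (hsep : ∀ n ∈ I, ∀ p ∈ C n, ∀ q ∈ C n, p ≠ q → s / 2 ^ n < |p - q|)
    (hR : ∀ n ∈ I, ∀ p ∈ C n, |p| ≤ R) :
    0 < volume {x : ℝ | {n : ℕ | n ∈ I ∧ ∃ p ∈ C n, |x - p| ≤ s / 2 ^ n / (2 * n)}.Infinite} := by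
  set E : ℕ → Set ℝ := fun n => ⋃ p ∈ C n,
    Icc (p - s / 2 ^ n / (2 * n)) (p + s / 2 ^ n / (2 * n)) with hEdef
  have hmemE : ∀ n x, x ∈ E n ↔ ∃ p ∈ C n, |x - p| ≤ s / 2 ^ n / (2 * n) := by
    intro n x
    simp only [hEdef, mem_iUnion, exists_prop, mem_Icc, abs_le]
    refine exists_congr fun p => and_congr_right fun _ => ?_
    constructor <;> rintro ⟨h1, h2⟩ <;> constructor <;> linarith
  set U : ℕ → Set ℝ := fun N => ⋃ n ∈ {n | n ∈ I ∧ N ≤ n}, E n with hUdef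
  have hUm : ∀ N, MeasurableSet (U N) := fun N =>
    MeasurableSet.biUnion (to_countable _) fun n _ =>
      (C n).measurableSet_biUnion fun _ _ => measurableSet_Icc
  have hUanti : Antitone U := fun M N hMN =>
    biUnion_mono (fun n hn => ⟨hn.1, hMN.trans hn.2⟩) fun _ _ => le_rfl
  have hUsub : ∀ N, U N ⊆ Icc (-(R + s)) (R + s) := by
    intro N
    refine iUnion₂_subset fun n hn x hx => ?_
    obtain ⟨p, hp, hxp⟩ := (hmemE n x).1 hx
    have h1 := abs_le.1 (hR n hn.1 p hp)
    have h2 : s / 2 ^ n / (2 * n) ≤ s := by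
      have hn1 : (1 : ℝ) ≤ n := by exact_mod_cast hI n hn.1
      rw [div_div]
      refine div_le_self hs.le ?_
      have := one_le_pow₀ (M₀ := ℝ) one_le_two (n := n)
      nlinarith
    have h3 := abs_le.1 (hxp.trans h2)
    exact ⟨by linarith, by linarith⟩
  have hUfin : ∀ N, volume (U N) ≠ ⊤ := fun N =>
    measure_ne_top_of_subset (hUsub N) measure_Icc_lt_top.ne
  have hlow : ∀ N, ENNReal.ofReal (s / 36) ≤ volume (U N) := by
    intro N
    have hdivN : ¬ Summable fun n : ℕ => (I.indicator fun n : ℕ => (1 / n : ℝ)) (n + N) := by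
      rwa [summable_nat_add_iff]
    have hnn : ∀ n : ℕ, 0 ≤ (I.indicator fun n : ℕ => (1 / n : ℝ)) n := fun n =>
      indicator_nonneg (fun _ _ => by positivity) n
    have htend := (not_summable_iff_tendsto_nat_atTop_of_nonneg (fun n => hnn (n + N))).1 hdivN
    obtain ⟨M, hM⟩ := (htend.eventually_ge_atTop 1).exists
    classical
    -- The part of `I` between `N` and `N + M`, whose reciprocals sum to at least `1`.
    set F := ((Finset.range M).map (addRightEmbedding N)).filter (· ∈ I) with hFdef
    have hFI : ∀ n ∈ F, n ∈ I ∧ N ≤ n := by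
      intro n hn
      simp only [hFdef, Finset.mem_filter, Finset.mem_map, addRightEmbedding_apply] at hn
      obtain ⟨⟨a, _, rfl⟩, h⟩ := hn
      exact ⟨h, by omega⟩
    have hS : 1 ≤ ∑ n ∈ F, (1 / n : ℝ) := by
      rw [hFdef, Finset.sum_filter, Finset.sum_map]
      refine hM.trans (le_of_eq (Finset.sum_congr rfl fun n _ => ?_))
      simp [indicator]
    have h := div_le_measureReal_biUnion_biUnion_Icc hs (C := C) (fun n hn => hI n (hFI n hn).1) hS
      (fun n hn => hcard n (hFI n hn).1) (fun n hn => hcard' n (hFI n hn).1)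
      (fun n hn => hsep n (hFI n hn).1)
    refine (ENNReal.ofReal_le_of_le_toReal (h.trans ?_))
    exact measureReal_mono (biUnion_mono (fun n hn => hFI n hn) fun _ _ => le_rfl) (hUfin N)
  have hinter : ⋂ N, U N ⊆ {x : ℝ | {n : ℕ | n ∈ I ∧ ∃ p ∈ C n,
      |x - p| ≤ s / 2 ^ n / (2 * n)}.Infinite} := by
    intro x hx
    refine Set.infinite_of_not_bddAbove fun ⟨B, hB⟩ => ?_
    have := mem_iInter.1 hx (B + 1)
    simp only [hUdef, mem_iUnion, mem_ofPred_eq, exists_prop] at this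
    obtain ⟨n, ⟨hnI, hn⟩, hxn⟩ := this
    have := hB ⟨hnI, (hmemE n x).1 hxn⟩
    omega
  refine lt_of_lt_of_le ?_ (measure_mono hinter)
  rw [hUanti.measure_iInter (fun N => (hUm N).nullMeasurableSet) ⟨0, hUfin 0⟩]
  exact lt_of_lt_of_le (ENNReal.ofReal_pos.2 (by positivity)) (le_iInf hlow)

/-! ### Products of copies of one probability measure -/

/-- Replacing one coordinate of a family of independent, identically distributed variables by an
independent copy does not change the law of the family. -/
theorem measurePreserving_update_infinitePi {ι X : Type*} [DecidableEq ι] [MeasurableSpace X]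
    (μ : Measure X) [IsProbabilityMeasure μ] (v : ι) :
    MeasurePreserving (fun p : X × (ι → X) => Function.update p.2 v p.1)
      (μ.prod (Measure.infinitePi fun _ : ι => μ)) (Measure.infinitePi fun _ : ι => μ) := by
  have hm : Measurable (fun p : X × (ι → X) => Function.update p.2 v p.1) := by
    refine measurable_pi_iff.2 fun w => ?_
    by_cases h : w = v
    · subst h; simpa using measurable_fst
    · simp only [Function.update_of_ne h]; fun_prop
  refine ⟨hm, Measure.eq_infinitePi _ fun s t ht => ?_⟩
  rw [Measure.map_apply hm (MeasurableSet.pi s.countable_toSet fun i _ => ht i)]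
  by_cases hv : v ∈ s
  · have : (fun p : X × (ι → X) => Function.update p.2 v p.1) ⁻¹' (Set.pi s t)
        = t v ×ˢ (Set.pi (s.erase v : Finset ι) t) := by
      ext p
      simp only [mem_preimage, Set.mem_pi, mem_prod, Finset.mem_coe, Finset.mem_erase]
      constructor
      · intro h
        refine ⟨by simpa using h v hv, fun i hi => ?_⟩
        simpa [Function.update_of_ne hi.1] using h i hi.2
      · rintro ⟨h1, h2⟩ i hi
        by_cases hiv : i = v
        · subst hiv; simpa using h1
        · simpa [Function.update_of_ne hiv] using h2 i ⟨hiv, hi⟩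
    rw [this, Measure.prod_prod, Measure.infinitePi_pi _ fun i _ => ht i,
      Finset.mul_prod_erase s (fun i => μ (t i)) hv]
  · have : (fun p : X × (ι → X) => Function.update p.2 v p.1) ⁻¹' (Set.pi s t)
        = univ ×ˢ (Set.pi s t) := by
      ext p
      simp only [mem_preimage, Set.mem_pi, mem_prod, Finset.mem_coe, mem_univ, true_and]
      refine forall₂_congr fun i hi => ?_
      rw [Function.update_of_ne (by rintro rfl; exact hv hi)]
    rw [this, Measure.prod_prod, Measure.infinitePi_pi _ fun i _ => ht i]
    simp

/-- An event is unlikely if, whatever the other coordinates are, it is unlikely as an event in the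
coordinate `v` alone. -/
theorem infinitePi_le_of_forall_update_le {ι X : Type*} [DecidableEq ι] [MeasurableSpace X]
    (μ : Measure X) [IsProbabilityMeasure μ] (v : ι) {E : Set (ι → X)} (hE : MeasurableSet E)
    {B : ENNReal} (h : ∀ r, μ {x | Function.update r v x ∈ E} ≤ B) :
    Measure.infinitePi (fun _ : ι => μ) E ≤ B := by
  have hmp := measurePreserving_update_infinitePi μ v
  rw [← hmp.measure_preimage hE.nullMeasurableSet,
    Measure.prod_apply_symm (hmp.measurable hE)]
  calc ∫⁻ r, μ ((fun x => (x, r)) ⁻¹' ((fun p : X × (ι → X) => Function.update p.2 v p.1) ⁻¹' E))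
        ∂Measure.infinitePi (fun _ : ι => μ)
      ≤ ∫⁻ _, B ∂Measure.infinitePi (fun _ : ι => μ) := lintegral_mono fun r => h r
    _ = B := by simp

theorem measurePreserving_comp_infinitePi {ι κ X : Type*} [MeasurableSpace X]
    (μ : Measure X) [IsProbabilityMeasure μ] {e : κ → ι} (he : Function.Injective e) :
    MeasurePreserving (fun (r : ι → X) k => r (e k)) (Measure.infinitePi fun _ : ι => μ)
      (Measure.infinitePi fun _ : κ => μ) := by
  have hm : Measurable (fun (r : ι → X) k => r (e k)) := by fun_prop
  refine ⟨hm, Measure.eq_infinitePi _ fun s t ht => ?_⟩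
  classical
  rw [Measure.map_apply hm (MeasurableSet.pi s.countable_toSet fun i _ => ht i)]
  rcases isEmpty_or_nonempty κ with hκ | hκ
  · have : s = ∅ := Finset.eq_empty_of_isEmpty s
    subst this; simp
  · have : (fun (r : ι → X) k => r (e k)) ⁻¹' (Set.pi s t)
        = Set.pi (s.map ⟨e, he⟩ : Finset ι) (fun i => t (Function.invFun e i)) := by
      ext r
      simp [Set.mem_pi, Function.leftInverse_invFun he _]
    rw [this, Measure.infinitePi_pi _ fun i _ => ht _, Finset.prod_map]
    simp [Function.leftInverse_invFun he _]

/-! ### Decay of products of independent ratios -/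

theorem integrable_log_uniformLaw (r₁ r₂ : ℝ) : Integrable Real.log (uniformLaw r₁ r₂) := by
  unfold uniformLaw ProbabilityTheory.cond
  rcases lt_or_ge r₁ r₂ with h | h
  · refine Integrable.smul_measure ?_ (by simp [h])
    have := (intervalIntegral.intervalIntegrable_log' (a := r₁) (b := r₂))
    exact (intervalIntegrable_iff_integrableOn_Icc_of_le h.le).1 this
  · have : volume.restrict (Icc r₁ r₂) = 0 := by
      rw [Measure.restrict_eq_zero, Real.volume_Icc]; simpa using h
    simp [this]

theorem ae_uniformLaw_mem_Icc (r₁ r₂ : ℝ) : ∀ᵐ x ∂uniformLaw r₁ r₂, x ∈ Icc r₁ r₂ :=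
  ae_cond_mem measurableSet_Icc

theorem ae_uniformLaw_pos {r₁ : ℝ} (h₀ : 0 ≤ r₁) (r₂ : ℝ) : ∀ᵐ x ∂uniformLaw r₁ r₂, 0 < x := by
  have h1 := ae_uniformLaw_mem_Icc r₁ r₂
  have h2 : ∀ᵐ x ∂uniformLaw r₁ r₂, x ≠ 0 := by
    refine (cond_absolutelyContinuous (μ := volume) (s := Icc r₁ r₂)).ae_le ?_
    exact Measure.ae_ne volume 0
  filter_upwards [h1, h2] with x hx hx0
  exact lt_of_le_of_ne (h₀.trans hx.1) (Ne.symm hx0)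

theorem uniformLaw_le {r₁ r₂ : ℝ} (h : r₁ < r₂) (S : Set ℝ) :
    uniformLaw r₁ r₂ S ≤ ENNReal.ofReal (1 / (r₂ - r₁)) * volume (Icc r₁ r₂ ∩ S) := by
  unfold uniformLaw
  rw [cond_apply measurableSet_Icc, Real.volume_Icc, one_div,
    ENNReal.ofReal_inv_of_pos (by linarith)]

/-- By the strong law of large numbers, the partial products of a sequence of independent
`uniformLaw`-variables almost surely decay no faster than `exp (-γ k)`. -/
theorem ae_eventually_exp_le_prod {r₁ r₂ γ : ℝ} (h₀ : 0 ≤ r₁) (h₁₂ : r₁ < r₂)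
    (hγ : -∫ x, Real.log x ∂(uniformLaw r₁ r₂) < γ) :
    ∀ᵐ x ∂(Measure.infinitePi fun _ : ℕ => uniformLaw r₁ r₂),
      (∀ j, 0 < x j) ∧ ∀ᶠ k : ℕ in atTop, Real.exp (-γ * k) ≤ ∏ j ∈ Finset.range k, x j := by
  have := isProbabilityMeasure_uniformLaw h₁₂
  set μ := uniformLaw r₁ r₂
  have hmp := measurePreserving_eval_infinitePi (fun _ : ℕ => μ)
  have hlog := integrable_log_uniformLaw r₁ r₂
  have hind : iIndepFun (fun (i : ℕ) (x : ℕ → ℝ) => Real.log (x i))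
      (Measure.infinitePi fun _ : ℕ => μ) :=
    iIndepFun_infinitePi (P := fun _ : ℕ => μ) (X := fun _ => Real.log)
      fun _ => Real.measurable_log
  have hslln := strong_law_ae_real (μ := Measure.infinitePi fun _ : ℕ => μ)
    (fun (i : ℕ) (x : ℕ → ℝ) => Real.log (x i)) ((hmp 0).integrable_comp_of_integrable hlog)
    (fun i j hij => hind.indepFun hij)
    (fun i => by
      have hm : ∀ i : ℕ, Measurable fun x : ℕ → ℝ => Real.log (x i) := fun i => by fun_prop
      refine ⟨(hm i).aemeasurable, (hm 0).aemeasurable, ?_⟩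
      have h : ∀ i : ℕ, Measure.map (fun x : ℕ → ℝ => Real.log (x i))
          (Measure.infinitePi fun _ : ℕ => μ) = μ.map Real.log := fun i => by
        conv_rhs => rw [← (hmp i).map_eq, Measure.map_map Real.measurable_log (hmp i).measurable]
        rfl
      rw [h, h])
  have hmean : ∫ x, Real.log (x 0) ∂(Measure.infinitePi fun _ : ℕ => μ) = ∫ x, Real.log x ∂μ := by
    conv_rhs => rw [← (hmp 0).map_eq]
    rw [integral_map (hmp 0).measurable.aemeasurable Real.measurable_log.aestronglyMeasurable]
  rw [hmean] at hslln
  have hpos : ∀ᵐ x ∂(Measure.infinitePi fun _ : ℕ => μ), ∀ j, 0 < x j :=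
    ae_all_iff.2 fun j => (hmp j).quasiMeasurePreserving.ae (ae_uniformLaw_pos h₀ r₂)
  filter_upwards [hslln, hpos] with x hx hxpos
  refine ⟨hxpos, ?_⟩
  have hev := hx.eventually (lt_mem_nhds (show -γ < _ by linarith))
  filter_upwards [hev, eventually_gt_atTop 0] with k hk hk0
  have hk0' : (0 : ℝ) < k := by exact_mod_cast hk0
  rw [lt_div_iff₀ hk0', ← Real.log_prod fun j _ => (hxpos j).ne'] at hk
  rw [← Real.le_log_iff_exp_le (Finset.prod_pos fun j _ => hxpos j)]
  exact hk.le

/-- Outside an event of small probability the decay of the partial products is bounded below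
uniformly, with a constant `c`. -/
theorem exists_measure_exists_prod_lt_le {r₁ r₂ γ : ℝ} (h₀ : 0 ≤ r₁) (h₁₂ : r₁ < r₂)
    (hγ : -∫ x, Real.log x ∂(uniformLaw r₁ r₂) < γ) {ε : ENNReal} (hε : 0 < ε) :
    ∃ c > (0 : ℝ), Measure.infinitePi (fun _ : ℕ => uniformLaw r₁ r₂)
      {x | ∃ k : ℕ, ∏ j ∈ Finset.range k, x j < c * Real.exp (-γ * k)} ≤ ε := by
  have := isProbabilityMeasure_uniformLaw h₁₂
  set P := Measure.infinitePi (fun _ : ℕ => uniformLaw r₁ r₂)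
  set A : ℕ → Set (ℕ → ℝ) := fun m =>
    {x | ∃ k : ℕ, ∏ j ∈ Finset.range k, x j < Real.exp (-m) * Real.exp (-γ * k)} with hA
  have hAm : ∀ m, MeasurableSet (A m) := fun m => by
    have : A m = ⋃ k : ℕ, {x : ℕ → ℝ |
        ∏ j ∈ Finset.range k, x j < Real.exp (-m) * Real.exp (-γ * k)} := by
      ext x; simp [hA]
    rw [this]
    exact MeasurableSet.iUnion fun k => measurableSet_lt (by fun_prop) measurable_const
  have hanti : Antitone A := fun m n hmn x ⟨k, hk⟩ => ⟨k, hk.trans_le (by gcongr)⟩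
  -- Eventually the decay is slow enough, and the finitely many remaining products are positive,
  -- so that a small constant `exp (-m)` takes care of them.
  have hnull : P (⋂ m, A m) = 0 := by
    refine measure_mono_null ?_ (ae_iff.1 (ae_eventually_exp_le_prod h₀ h₁₂ hγ))
    rintro x hx ⟨hpos, hev⟩
    obtain ⟨K, hK⟩ := eventually_atTop.1 hev
    have hprod : ∀ k, 0 < ∏ j ∈ Finset.range k, x j := fun k => Finset.prod_pos fun j _ => hpos j
    obtain ⟨m, hm⟩ : ∃ m : ℕ, ∀ k < K, Real.exp (-m) * Real.exp (-γ * k)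
        ≤ ∏ j ∈ Finset.range k, x j := by
      have htend : ∀ k : ℕ, Tendsto (fun m : ℕ => Real.exp (-m) * Real.exp (-γ * k)) atTop (𝓝 0) :=
        fun k => by
          simpa using ((Real.tendsto_exp_neg_atTop_nhds_zero.comp
            tendsto_natCast_atTop_atTop).mul_const (Real.exp (-γ * k)))
      have : ∀ᶠ m : ℕ in atTop, ∀ k ∈ Finset.range K, Real.exp (-m) * Real.exp (-γ * k)
          ≤ ∏ j ∈ Finset.range k, x j :=
        (Filter.eventually_all_finset _).2 fun k _ =>
          ((htend k).eventually (gt_mem_nhds (hprod k))).mono fun _ h => le_of_lt h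
      obtain ⟨m, hm⟩ := this.exists
      exact ⟨m, fun k hk => hm k (Finset.mem_range.2 hk)⟩
    obtain ⟨k, hk⟩ := mem_iInter.1 hx m
    rcases lt_or_ge k K with h | h
    · exact absurd (hm k h) (not_le.2 hk)
    · refine absurd (hK k h) (not_le.2 (hk.trans_le ?_))
      refine mul_le_of_le_one_left (Real.exp_pos _).le ?_
      simp
  have htend := tendsto_measure_iInter_atTop (μ := P) (fun m => (hAm m).nullMeasurableSet) hanti
    ⟨0, measure_ne_top _ _⟩
  rw [hnull] at htend
  obtain ⟨m, hm⟩ := (htend.eventually (gt_mem_nhds hε)).exists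
  exact ⟨Real.exp (-m), Real.exp_pos _, hm.le⟩

/-! ### Events that occur for a divergent part of the harmonic series -/

/-- If each of the events `F n` fails with probability at most `δ`, then with probability at least
`1 - δ` the harmonic series restricted to those `n` for which `F n` occurs diverges. -/
theorem measure_tsum_indicator_ne_top_le {Ω : Type*} [MeasurableSpace Ω] {P : Measure Ω}
    [IsProbabilityMeasure P] {F : ℕ → Set Ω} (hF : ∀ n, MeasurableSet (F n)) {δ : ENNReal}
    (hδ : ∀ n, P (F n)ᶜ ≤ δ) :
    P {ω | ∑' n : ℕ, (F n).indicator (fun _ => ((n : ENNReal) + 1)⁻¹) ω ≠ ⊤} ≤ δ := by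
  set f : Ω → ENNReal := fun ω => ∑' n : ℕ, (F n).indicator (fun _ => ((n : ENNReal) + 1)⁻¹) ω
    with hf
  have hfm : Measurable f := by
    rw [hf]
    exact Measurable.tsum fun n => measurable_const.indicator (hF n)
  have hharm : ∑' n : ℕ, ((n : ENNReal) + 1)⁻¹ = ⊤ := by
    by_contra h
    have h1 := ENNReal.summable_toReal h
    refine Real.not_summable_one_div_natCast ((summable_nat_add_iff 1).1 (h1.congr fun n => ?_))
    rw [ENNReal.toReal_inv, ENNReal.toReal_add (by simp) (by simp)]
    simp
  -- On the event `f ≤ K` the integral of `f` is at most `K`, but each `F n` contributes at least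
  -- `(n + 1)⁻¹` times the excess of the probability of this event over `δ`.
  have hK : ∀ K : ℕ, P {ω | f ω ≤ K} ≤ δ := by
    intro K
    by_contra! hlt
    set D := {ω | f ω ≤ K} with hD
    have hDm : MeasurableSet D := measurableSet_le hfm measurable_const
    have h1 : ∫⁻ ω in D, f ω ∂P ≤ K := by
      calc ∫⁻ ω in D, f ω ∂P ≤ ∫⁻ _ in D, K ∂P := setLIntegral_mono measurable_const fun ω hω => hω
        _ = K * P D := by simp
        _ ≤ K * 1 := by gcongr; exact prob_le_one
        _ = K := mul_one _
    have h2 : ∫⁻ ω in D, f ω ∂P = ∑' n : ℕ, ((n : ENNReal) + 1)⁻¹ * P (F n ∩ D) := by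
      rw [hf, lintegral_tsum fun n => (measurable_const.indicator (hF n)).aemeasurable]
      refine tsum_congr fun n => ?_
      rw [lintegral_indicator_const (hF n), Measure.restrict_apply (hF n)]
    have h3 : ∀ n, P D - δ ≤ P (F n ∩ D) := by
      intro n
      refine tsub_le_iff_right.2 ?_
      calc P D ≤ P (F n ∩ D) + P (F n)ᶜ := by
            refine (measure_mono fun ω hω => ?_).trans (measure_union_le _ _)
            by_cases h : ω ∈ F n
            · exact Or.inl ⟨h, hω⟩
            · exact Or.inr h
        _ ≤ _ := by gcongr; exact hδ n
    have h4 : ∑' n : ℕ, ((n : ENNReal) + 1)⁻¹ * (P D - δ) ≤ K := by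
      refine le_trans (ENNReal.tsum_le_tsum fun n => ?_) (h2 ▸ h1)
      gcongr
      exact h3 n
    rw [ENNReal.tsum_mul_right, hharm, ENNReal.top_mul (tsub_pos_of_lt hlt).ne'] at h4
    exact absurd (top_le_iff.1 h4) (ENNReal.natCast_ne_top K)
  have hU : {ω | f ω ≠ ⊤} = ⋃ K : ℕ, {ω | f ω ≤ K} := by
    ext ω
    simp only [mem_ofPred_eq, mem_iUnion]
    constructor
    · intro h
      obtain ⟨K, hK⟩ := ENNReal.exists_nat_gt h
      exact ⟨K, hK.le⟩
    · rintro ⟨K, hK⟩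
      exact (hK.trans_lt (ENNReal.natCast_lt_top K)).ne
  rw [hU, Monotone.measure_iUnion]
  · exact iSup_le hK
  · intro K L hKL ω hω
    exact le_trans (show f ω ≤ K from hω) (by exact_mod_cast hKL)

theorem measurable_card_filter_notMem {Ω ι : Type*} [MeasurableSpace Ω] [Fintype ι]
    {B : ι → Set Ω} (hB : ∀ i, MeasurableSet (B i)) [∀ ω, DecidablePred fun i => ω ∉ B i] :
    Measurable fun ω => ((Finset.univ.filter fun i => ω ∉ B i).card : ℝ) := by
  have : (fun ω => ((Finset.univ.filter fun i => ω ∉ B i).card : ℝ))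
      = fun ω => ∑ i, (B i)ᶜ.indicator (fun _ => (1 : ℝ)) ω := by
    ext ω
    rw [Finset.card_filter]
    push_cast
    refine Finset.sum_congr rfl fun i _ => ?_
    by_cases h : ω ∈ B i <;> simp [h]
  rw [this]
  exact Finset.measurable_fun_sum _ fun i _ => measurable_const.indicator (hB i).compl

/-- By Markov's inequality, if finitely many events each have probability at most `ε`, then with
probability at least `1 - 2 ε` at least half of them fail. -/
theorem measure_card_filter_notMem_lt_le {Ω ι : Type*} [MeasurableSpace Ω] {P : Measure Ω}
    [Fintype ι] [Nonempty ι] {B : ι → Set Ω} (hB : ∀ i, MeasurableSet (B i))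
    [∀ ω, DecidablePred fun i => ω ∉ B i] {ε : ENNReal} (hε : ∀ i, P (B i) ≤ ε) :
    P {ω | ((Finset.univ.filter fun i => ω ∉ B i).card : ℝ) < (Fintype.card ι : ℝ) / 2}
      ≤ 2 * ε := by
  classical
  set N := Fintype.card ι with hN
  have hN0 : (N : ENNReal) ≠ 0 := by simp [hN]
  have hNtop : (N : ENNReal) ≠ ⊤ := ENNReal.natCast_ne_top N
  set f : Ω → ENNReal := fun ω => ∑ i, (B i).indicator (fun _ => (1 : ENNReal)) ω with hf
  have hfm : Measurable f :=
    Finset.measurable_fun_sum _ fun i _ => measurable_const.indicator (hB i)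
  have hfcard : ∀ ω, f ω = (Finset.univ.filter fun i => ω ∈ B i).card := fun ω => by
    rw [Finset.card_filter]
    push_cast
    refine Finset.sum_congr rfl fun i _ => ?_
    by_cases h : ω ∈ B i <;> simp [h]
  have hint : ∫⁻ ω, f ω ∂P ≤ N * ε := by
    rw [hf, lintegral_finsetSum _ fun i _ => measurable_const.indicator (hB i)]
    calc ∑ i, ∫⁻ ω, (B i).indicator (fun _ => (1 : ENNReal)) ω ∂P ≤ ∑ _i : ι, ε :=
          Finset.sum_le_sum fun i _ => by
            rw [lintegral_indicator_const (hB i), one_mul]; exact hε i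
      _ = N * ε := by simp [hN]
  have hsub : {ω | ((Finset.univ.filter fun i => ω ∉ B i).card : ℝ) < (N : ℝ) / 2}
      ⊆ {ω | (N : ENNReal) ≤ 2 * f ω} := by
    intro ω hω
    have h1 : (Finset.univ.filter fun i => ω ∈ B i).card
        + (Finset.univ.filter fun i => ω ∉ B i).card = N := by
      rw [Finset.card_filter_add_card_filter_not]; rfl
    have h2 : ((Finset.univ.filter fun i => ω ∈ B i).card : ℝ)
        + (Finset.univ.filter fun i => ω ∉ B i).card = N := by exact_mod_cast h1
    have h3 : (N : ℝ) ≤ 2 * (Finset.univ.filter fun i => ω ∈ B i).card := by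
      have : ((Finset.univ.filter fun i => ω ∉ B i).card : ℝ) < (N : ℝ) / 2 := hω
      linarith
    have h4 : N ≤ 2 * (Finset.univ.filter fun i => ω ∈ B i).card := by exact_mod_cast h3
    rw [mem_ofPred_eq, hfcard]
    exact_mod_cast h4
  have hmarkov := mul_meas_ge_le_lintegral (μ := P) (hfm.const_mul 2) (N : ENNReal)
  rw [lintegral_const_mul _ hfm] at hmarkov
  have h5 : (N : ENNReal) * P {ω | (N : ENNReal) ≤ 2 * f ω} ≤ N * (2 * ε) := by
    refine hmarkov.trans ?_
    calc 2 * ∫⁻ ω, f ω ∂P ≤ 2 * (N * ε) := by gcongr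
      _ = N * (2 * ε) := by ring
  exact (measure_mono hsub).trans ((ENNReal.mul_le_mul_iff_right hN0 hNtop).1 h5)

/-! ### Factorisation of the projection along a prefix -/

/-- The product `r_{u₁} r_{u₁u₂} ⋯ r_{u₁…u_k}` of the ratios along the first `k` letters of `u`. -/
def prefixProd (r : Word → ℝ) (u : Stream' (Fin 2)) (k : ℕ) : ℝ :=
  ∏ j ∈ Finset.range k, r (initialWord u j)

/-- The projection of the sequence `u` with its first `k + 1` letters removed, formed with the
ratios that sit below the prefix of length `k + 1`. -/
def tailProj (t : Fin 2 → ℝ) (r : Word → ℝ) (u : Stream' (Fin 2)) (k : ℕ) : ℝ :=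
  ∑' i : ℕ, t (u.get (k + 1 + i)) * ∏ j ∈ Finset.range i, r (initialWord u (k + 1 + j))

/-- The families of ratios with all values in `[r₁, r₂]`. -/
def ratioBox (r₁ r₂ : ℝ) : Set (Word → ℝ) := {r | ∀ w, r w ∈ Icc r₁ r₂}

theorem initialWord_eq_iff {u w : Stream' (Fin 2)} {i j : ℕ} :
    initialWord u i = initialWord w j ↔ i = j ∧ ∀ l ≤ i, u.get l = w.get l := by
  constructor
  · intro h
    have h' : u.take (i + 1) = w.take (j + 1) := congrArg Subtype.val h
    have hij : i = j := by simpa using congrArg List.length h'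
    subst hij
    refine ⟨rfl, fun l hl => ?_⟩
    have h1 := Stream'.getElem?_take (s := u) (Nat.lt_succ_of_le hl)
    have h2 := Stream'.getElem?_take (s := w) (Nat.lt_succ_of_le hl)
    have : some (u.get l) = some (w.get l) := by rw [← h1, ← h2, Nat.succ_eq_add_one, h']
    exact Option.some.inj this
  · rintro ⟨rfl, h⟩
    refine Subtype.ext (List.ext_getElem (by simp [initialWord]) fun l h1 h2 => ?_)
    simp only [initialWord, Stream'.take_get]
    refine h l ?_
    simp only [initialWord, Stream'.length_take] at h1
    omega

theorem initialWord_injective (u : Stream' (Fin 2)) : Function.Injective (initialWord u) :=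
  fun _ _ h => (initialWord_eq_iff.1 h).1

theorem prefixProd_congr {u w : Stream' (Fin 2)} {k : ℕ} (h : ∀ j < k, u.get j = w.get j)
    (r : Word → ℝ) : prefixProd r u k = prefixProd r w k :=
  Finset.prod_congr rfl fun _ hj => congrArg r (initialWord_eq_iff.2
    ⟨rfl, fun l hl => h l (hl.trans_lt (Finset.mem_range.1 hj))⟩)

theorem measurable_prefixProd (u : Stream' (Fin 2)) (k : ℕ) :
    Measurable fun r => prefixProd r u k := by
  unfold prefixProd; fun_prop

theorem measurable_tailProj (t : Fin 2 → ℝ) (u : Stream' (Fin 2)) (k : ℕ) :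
    Measurable fun r => tailProj t r u k := by
  unfold tailProj; fun_prop

theorem measurable_proj (t : Fin 2 → ℝ) (u : Stream' (Fin 2)) :
    Measurable fun r => proj t r u := by
  unfold proj; fun_prop

theorem measurableSet_ratioBox (r₁ r₂ : ℝ) : MeasurableSet (ratioBox r₁ r₂) := by
  have : ratioBox r₁ r₂ = ⋂ w, {r | r w ∈ Icc r₁ r₂} := by ext r; simp [ratioBox]
  rw [this]
  exact MeasurableSet.iInter fun w => (measurable_pi_apply w) measurableSet_Icc

theorem ae_mem_ratioBox {r₁ r₂ : ℝ} (h₁₂ : r₁ < r₂) :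
    ∀ᵐ r ∂ratioLaw r₁ r₂, r ∈ ratioBox r₁ r₂ := by
  have := isProbabilityMeasure_uniformLaw h₁₂
  exact ae_all_iff.2 fun w => (measurePreserving_eval_infinitePi
    (fun _ : Word => uniformLaw r₁ r₂) w).quasiMeasurePreserving.ae (ae_uniformLaw_mem_Icc r₁ r₂)

theorem norm_proj_term_le {t : Fin 2 → ℝ} {r₁ r₂ : ℝ} (h₀ : 0 ≤ r₁) {r : Word → ℝ}
    (hr : r ∈ ratioBox r₁ r₂) (u : Stream' (Fin 2)) (k : ℕ) :
    ‖t (u.get k) * ∏ j ∈ Finset.range k, r (initialWord u j)‖ ≤ (|t 0| + |t 1|) * r₂ ^ k := by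
  have ht : ∀ i, |t i| ≤ |t 0| + |t 1| := fun i => by
    fin_cases i <;> simp
  rw [norm_mul, Real.norm_eq_abs, Real.norm_eq_abs, Finset.abs_prod]
  refine mul_le_mul (ht _) ?_ (Finset.prod_nonneg fun _ _ => abs_nonneg _) (by positivity)
  calc ∏ j ∈ Finset.range k, |r (initialWord u j)| ≤ ∏ _j ∈ Finset.range k, r₂ :=
        Finset.prod_le_prod (fun _ _ => abs_nonneg _) fun j _ => by
          have := hr (initialWord u j)
          rw [abs_of_nonneg (h₀.trans this.1)]
          exact this.2
    _ = r₂ ^ k := by simp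

theorem summable_proj {t : Fin 2 → ℝ} {r₁ r₂ : ℝ} (h₀ : 0 ≤ r₁) (h₁₂ : r₁ < r₂) (h₂ : r₂ < 1)
    {r : Word → ℝ} (hr : r ∈ ratioBox r₁ r₂) (u : Stream' (Fin 2)) :
    Summable fun k => t (u.get k) * ∏ j ∈ Finset.range k, r (initialWord u j) :=
  Summable.of_norm_bounded ((summable_geometric_of_lt_one (by linarith) h₂).mul_left _)
    (norm_proj_term_le h₀ hr u)

theorem abs_proj_le {t : Fin 2 → ℝ} {r₁ r₂ : ℝ} (h₀ : 0 ≤ r₁) (h₁₂ : r₁ < r₂) (h₂ : r₂ < 1)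
    {r : Word → ℝ} (hr : r ∈ ratioBox r₁ r₂) (u : Stream' (Fin 2)) :
    |proj t r u| ≤ (|t 0| + |t 1|) * (1 - r₂)⁻¹ :=
  tsum_of_norm_bounded ((hasSum_geometric_of_lt_one (by linarith) h₂).mul_left _)
    (norm_proj_term_le h₀ hr u)

theorem proj_eq_sum_add {t : Fin 2 → ℝ} {r₁ r₂ : ℝ} (h₀ : 0 ≤ r₁) (h₁₂ : r₁ < r₂) (h₂ : r₂ < 1)
    {r : Word → ℝ} (hr : r ∈ ratioBox r₁ r₂) (u : Stream' (Fin 2)) (k : ℕ) :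
    proj t r u = ∑ i ∈ Finset.range k, t (u.get i) * prefixProd r u i
      + prefixProd r u k * (t (u.get k) + r (initialWord u k) * tailProj t r u k) := by
  have h := (summable_proj (t := t) h₀ h₁₂ h₂ hr u).sum_add_tsum_nat_add (k + 1)
  have htail : ∑' i, t (u.get (i + (k + 1)))
      * ∏ j ∈ Finset.range (i + (k + 1)), r (initialWord u j)
      = prefixProd r u k * r (initialWord u k) * tailProj t r u k := by
    rw [tailProj, ← tsum_mul_left]
    refine tsum_congr fun i => ?_
    rw [add_comm i (k + 1), Finset.prod_range_add, Finset.prod_range_succ]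
    unfold prefixProd
    ring
  rw [htail, Finset.sum_range_succ] at h
  unfold proj
  rw [← h]
  unfold prefixProd
  ring

/-- If `u` and `w` have a common prefix of length `k`, the ratios along it factor out of the
difference of their projections. -/
theorem proj_sub_proj {t : Fin 2 → ℝ} {r₁ r₂ : ℝ} (h₀ : 0 ≤ r₁) (h₁₂ : r₁ < r₂) (h₂ : r₂ < 1)
    {r : Word → ℝ} (hr : r ∈ ratioBox r₁ r₂) {u w : Stream' (Fin 2)} {k : ℕ}
    (hag : ∀ j < k, u.get j = w.get j) :
    proj t r u - proj t r w = prefixProd r u k * (t (u.get k) - t (w.get k)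
      + r (initialWord u k) * tailProj t r u k - r (initialWord w k) * tailProj t r w k) := by
  rw [proj_eq_sum_add h₀ h₁₂ h₂ hr u k, proj_eq_sum_add h₀ h₁₂ h₂ hr w k,
    prefixProd_congr hag]
  have : ∑ i ∈ Finset.range k, t (u.get i) * prefixProd r u i
      = ∑ i ∈ Finset.range k, t (w.get i) * prefixProd r w i :=
    Finset.sum_congr rfl fun i hi => by
      rw [hag i (Finset.mem_range.1 hi),
        prefixProd_congr fun _ hj => hag _ (hj.trans (Finset.mem_range.1 hi))]
  rw [this]
  ring

/-! ### Transversality -/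

theorem volume_abs_add_mul_le {α β δ η : ℝ} (hη : 0 < η) (hβ : η ≤ |β|) :
    volume {x : ℝ | |α + x * β| ≤ δ} ≤ ENNReal.ofReal (2 * (δ / η)) := by
  have hβ0 : β ≠ 0 := abs_pos.1 (hη.trans_le hβ)
  have hsub : {x : ℝ | |α + x * β| ≤ δ} ⊆ Icc (-(α / β) - δ / η) (-(α / β) + δ / η) := by
    intro x hx
    have h1 : |x + α / β| ≤ δ / η := by
      have : α + x * β = (x + α / β) * β := by field_simp; ring
      rw [mem_ofPred_eq, this, abs_mul] at hx
      rw [le_div_iff₀ hη]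
      exact (mul_le_mul_of_nonneg_left hβ (abs_nonneg _)).trans hx
    have := abs_le.1 h1
    exact ⟨by linarith, by linarith⟩
  refine (measure_mono hsub).trans ?_
  rw [Real.volume_Icc]
  exact ENNReal.ofReal_le_ofReal (by linarith)

/-- When the tail of `u` has a projection of size at least `η`, the difference of the projections
is an affine function of the single ratio at the prefix of length `k + 1` of `u`, with slope at
least `ρ * η`. -/
theorem ratioLaw_close_of_le_abs_tailProj_le (t : Fin 2 → ℝ) {r₁ r₂ : ℝ} (h₀ : 0 ≤ r₁)
    (h₁₂ : r₁ < r₂) (h₂ : r₂ < 1) {u w : Stream' (Fin 2)} {k : ℕ}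
    (hag : ∀ j < k, u.get j = w.get j) (hne : u.get k ≠ w.get k) {ρ η δ : ℝ} (hρ : 0 < ρ)
    (hη : 0 < η) :
    ratioLaw r₁ r₂ {r | r ∈ ratioBox r₁ r₂ ∧ ρ ≤ prefixProd r u k ∧ η ≤ |tailProj t r u k| ∧
      |proj t r u - proj t r w| ≤ δ} ≤ ENNReal.ofReal (2 * δ / (ρ * η * (r₂ - r₁))) := by
  have := isProbabilityMeasure_uniformLaw h₁₂
  set v := initialWord u k with hv
  refine infinitePi_le_of_forall_update_le (uniformLaw r₁ r₂) v ?_ fun r => ?_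
  · refine (measurableSet_ratioBox r₁ r₂).inter (MeasurableSet.inter ?_ (MeasurableSet.inter ?_ ?_))
    · exact measurableSet_le measurable_const (measurable_prefixProd u k)
    · exact measurableSet_le measurable_const (measurable_tailProj t u k).abs
    · exact measurableSet_le ((measurable_proj t u).sub (measurable_proj t w)).abs measurable_const
  · -- None of the other ingredients of `proj_sub_proj` involves the ratio at `v`.
    have hP : ∀ x, prefixProd (Function.update r v x) u k = prefixProd r u k := fun x =>
      Finset.prod_congr rfl fun j hj => Function.update_of_ne (fun h => by
        have := (initialWord_eq_iff.1 h).1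
        have := Finset.mem_range.1 hj
        omega) _ _
    have hTu : ∀ x, tailProj t (Function.update r v x) u k = tailProj t r u k := fun x =>
      tsum_congr fun i => congrArg _ (Finset.prod_congr rfl fun j _ => Function.update_of_ne
        (fun h => by have := (initialWord_eq_iff.1 h).1; omega) _ _)
    have hTw : ∀ x, tailProj t (Function.update r v x) w k = tailProj t r w k := fun x =>
      tsum_congr fun i => congrArg _ (Finset.prod_congr rfl fun j _ => Function.update_of_ne
        (fun h => by have := (initialWord_eq_iff.1 h).1; omega) _ _)
    have hw : ∀ x, Function.update r v x (initialWord w k) = r (initialWord w k) := fun x =>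
      Function.update_of_ne (fun h => hne ((initialWord_eq_iff.1 h).2 k le_rfl).symm) _ _
    by_cases hr : ρ ≤ prefixProd r u k ∧ η ≤ |tailProj t r u k|
    · have hslope : ρ * η ≤ |prefixProd r u k * tailProj t r u k| := by
        rw [abs_mul]
        exact mul_le_mul (hr.1.trans (le_abs_self _)) hr.2 hη.le (abs_nonneg _)
      have hsub : {x | Function.update r v x ∈ {r | r ∈ ratioBox r₁ r₂ ∧ ρ ≤ prefixProd r u k ∧
          η ≤ |tailProj t r u k| ∧ |proj t r u - proj t r w| ≤ δ}}
          ⊆ {x : ℝ | |prefixProd r u k * (t (u.get k) - t (w.get k)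
            - r (initialWord w k) * tailProj t r w k)
            + x * (prefixProd r u k * tailProj t r u k)| ≤ δ} := by
        rintro x ⟨hbox, -, -, hx⟩
        rw [proj_sub_proj h₀ h₁₂ h₂ hbox hag, hP, hTu, hTw, hw, ← hv,
          Function.update_self] at hx
        refine le_trans (le_of_eq (congrArg _ ?_)) hx
        ring
      have hlen : 0 < r₂ - r₁ := by linarith
      calc uniformLaw r₁ r₂ _ ≤ ENNReal.ofReal (1 / (r₂ - r₁)) * volume (Icc r₁ r₂ ∩ _) :=
            uniformLaw_le h₁₂ _
        _ ≤ ENNReal.ofReal (1 / (r₂ - r₁)) * ENNReal.ofReal (2 * (δ / (ρ * η))) := by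
            gcongr
            exact (measure_mono (inter_subset_right.trans hsub)).trans
              (volume_abs_add_mul_le (by positivity) hslope)
        _ = ENNReal.ofReal (2 * δ / (ρ * η * (r₂ - r₁))) := by
            rw [← ENNReal.ofReal_mul (by positivity)]
            congr 1
            field_simp
    · refine le_of_eq_of_le ?_ zero_le
      convert measure_empty (μ := uniformLaw r₁ r₂)
      refine eq_empty_of_forall_notMem ?_
      rintro x ⟨-, hx1, hx2, -⟩
      rw [hP] at hx1
      rw [hTu] at hx2
      exact hr ⟨hx1, hx2⟩

theorem abs_sub_of_ne (t : Fin 2 → ℝ) {i j : Fin 2} (h : i ≠ j) : |t i - t j| = |t 0 - t 1| := by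
  fin_cases i <;> fin_cases j <;> simp_all [abs_sub_comm]

/-- Transversality: two sequences separating after a prefix along which the ratios have product at
least `ρ` have projections within `δ` with probability `O(δ / ρ)`. If both tails had a small
projection, the first differing letter alone would keep the projections apart. -/
theorem ratioLaw_close_le (t : Fin 2 → ℝ) (ht : t 0 ≠ t 1) {r₁ r₂ : ℝ} (h₀ : 0 ≤ r₁)
    (h₁₂ : r₁ < r₂) (h₂ : r₂ < 1) {u w : Stream' (Fin 2)} {k : ℕ}
    (hag : ∀ j < k, u.get j = w.get j) (hne : u.get k ≠ w.get k) {ρ δ : ℝ} (hρ : 0 < ρ)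
    (hδ : 0 ≤ δ) (hδρ : δ < ρ * |t 0 - t 1| / 2) :
    ratioLaw r₁ r₂ {r | r ∈ ratioBox r₁ r₂ ∧ ρ ≤ prefixProd r u k ∧
      |proj t r u - proj t r w| ≤ δ}
      ≤ ENNReal.ofReal (16 * δ / (ρ * |t 0 - t 1| * (r₂ - r₁))) := by
  set D := |t 0 - t 1| with hD
  have hDpos : 0 < D := abs_pos.2 (sub_ne_zero.2 ht)
  have hlen : 0 < r₂ - r₁ := by linarith
  have hη : 0 < D / 4 := by positivity
  have hu := ratioLaw_close_of_le_abs_tailProj_le t h₀ h₁₂ h₂ hag hne hρ hη (δ := δ)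
  have hw := ratioLaw_close_of_le_abs_tailProj_le t h₀ h₁₂ h₂ (fun j hj => (hag j hj).symm)
    hne.symm hρ hη (δ := δ)
  calc _ ≤ _ := measure_mono (fun r hr => ?_)
    _ ≤ _ := measure_union_le _ _
    _ ≤ _ := add_le_add hu hw
    _ = _ := by
      rw [← ENNReal.ofReal_add (by positivity) (by positivity)]
      congr 1
      field_simp
      ring
  obtain ⟨hbox, hP, hclose⟩ := hr
  by_cases h1 : D / 4 ≤ |tailProj t r u k|
  · exact Or.inl ⟨hbox, hP, h1, hclose⟩
  by_cases h3 : D / 4 ≤ |tailProj t r w k|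
  · exact Or.inr ⟨hbox, (prefixProd_congr hag r) ▸ hP, h3, by rwa [abs_sub_comm]⟩
  exfalso
  push Not at h1 h3
  rw [proj_sub_proj h₀ h₁₂ h₂ hbox hag, abs_mul, abs_of_pos (hρ.trans_le hP)] at hclose
  have hratio : ∀ v, |r v| ≤ 1 := fun v => by
    rw [abs_of_nonneg (h₀.trans (hbox v).1)]
    exact (hbox v).2.trans h₂.le
  have hmul : ∀ v (y : ℝ), |r v * y| ≤ |y| := fun v y => by
    rw [abs_mul]; exact mul_le_of_le_one_left (abs_nonneg _) (hratio v)
  have hu' := (hmul (initialWord u k) (tailProj t r u k)).trans_lt h1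
  have hw' := (hmul (initialWord w k) (tailProj t r w k)).trans_lt h3
  have hdist : D / 2 ≤ |t (u.get k) - t (w.get k)
      + r (initialWord u k) * tailProj t r u k - r (initialWord w k) * tailProj t r w k| := by
    have h4 := abs_sub_of_ne t hne
    rw [← hD] at h4
    set A := t (u.get k) - t (w.get k)
    set B := r (initialWord u k) * tailProj t r u k
    set C := r (initialWord w k) * tailProj t r w k
    have h5 : |A| ≤ |A + B - C| + |B| + |C| := by
      calc |A| = |(A + B - C) - B + C| := by congr 1; ring
        _ ≤ |(A + B - C) - B| + |C| := abs_add_le _ _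
        _ ≤ _ := by gcongr; exact abs_sub _ _
    linarith
  have := mul_le_mul hP hdist (by positivity) (hρ.le.trans hP)
  linarith

/-! ### Words with a common continuation -/

/-- The infinite sequence `a₁ … aₙ b`. -/
abbrev extend (b : Stream' (Fin 2)) {n : ℕ} (a : Fin n → Fin 2) : Stream' (Fin 2) :=
  List.ofFn a ++ₛ b

theorem extend_get_lt (b : Stream' (Fin 2)) {n : ℕ} (a : Fin n → Fin 2) (j : Fin n) :
    (extend b a).get j = a j := by
  rw [extend, Stream'.get_append_left _ _ _ (by simp)]
  simp

theorem exists_first_difference (b : Stream' (Fin 2)) {n : ℕ} {a a' : Fin n → Fin 2}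
    (h : a ≠ a') : ∃ k < n, (∀ j < k, (extend b a).get j = (extend b a').get j) ∧
      (extend b a).get k ≠ (extend b a').get k := by
  obtain ⟨i, hi⟩ := Function.ne_iff.1 h
  have hex : ∃ k, (extend b a).get k ≠ (extend b a').get k :=
    ⟨i, by rwa [extend_get_lt, extend_get_lt]⟩
  classical
  refine ⟨Nat.find hex, ?_, fun j hj => not_not.1 (Nat.find_min hex hj), Nat.find_spec hex⟩
  exact (Nat.find_min' hex (by rwa [extend_get_lt, extend_get_lt])).trans_lt i.2

theorem card_filter_extend_eq_le (b : Stream' (Fin 2)) {n : ℕ} (a : Fin n → Fin 2) (k : ℕ) :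
    (Finset.univ.filter fun a' : Fin n → Fin 2 =>
      ∀ j < k, (extend b a).get j = (extend b a').get j).card ≤ 2 ^ (n - k) := by
  classical
  have hsub : (Finset.univ.filter fun a' : Fin n → Fin 2 =>
      ∀ j < k, (extend b a).get j = (extend b a').get j)
      ⊆ Fintype.piFinset fun j : Fin n => if (j : ℕ) < k then {a j} else Finset.univ := by
    intro a' ha'
    rw [Fintype.mem_piFinset]
    intro j
    split_ifs with h
    · have := (Finset.mem_filter.1 ha').2 j h
      rw [extend_get_lt, extend_get_lt] at this
      simp [this]
    · exact Finset.mem_univ _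
  refine (Finset.card_le_card hsub).trans ?_
  rw [Fintype.card_piFinset]
  have : ∀ j : Fin n, (if (j : ℕ) < k then {a j} else Finset.univ : Finset (Fin 2)).card
      = if (j : ℕ) < k then 1 else 2 := fun j => by split_ifs <;> simp
  simp only [this]
  rw [Fin.prod_univ_eq_prod_range (fun j => if j < k then 1 else 2) n, Finset.prod_ite]
  simp only [Finset.prod_const_one, one_mul, Finset.prod_const]
  refine Nat.pow_le_pow_right (by norm_num) ?_
  have : Finset.filter (fun x => ¬ x < k) (Finset.range n) = Finset.Ico k n := by
    ext x; simp; omega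
  rw [this]
  simp

/-- At a suitable scale `s`, every word `a` of every length `n` is unlikely to have another word
`a'` of the same length with `Π_r(a' b)` within `s / 2 ^ n` of `Π_r(a b)`. -/
theorem exists_forall_ratioLaw_exists_close_le (t : Fin 2 → ℝ) (ht : t 0 ≠ t 1) {r₁ r₂ : ℝ}
    (h₀ : 0 ≤ r₁) (h₁₂ : r₁ < r₂) (h₂ : r₂ < 1)
    (hlog : Real.log 2 > -∫ x, Real.log x ∂(uniformLaw r₁ r₂)) (b : Stream' (Fin 2))
    {ε : ENNReal} (hε : 0 < ε) :
    ∃ s : ℝ, 0 < s ∧ s ≤ 1 ∧ ∀ (n : ℕ) (a : Fin n → Fin 2),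
      ratioLaw r₁ r₂ {r | ∃ a' : Fin n → Fin 2, a' ≠ a ∧
        |proj t r (extend b a) - proj t r (extend b a')| ≤ s / 2 ^ n} ≤ ε := by
  have := isProbabilityMeasure_uniformLaw h₁₂
  obtain ⟨γ, hγ, hγ2⟩ := exists_between hlog
  obtain ⟨c, hc, hcP⟩ := exists_measure_exists_prod_lt_le h₀ h₁₂ hγ (ENNReal.half_pos hε.ne')
  obtain ⟨e, he, heε⟩ : ∃ e : ℝ, 0 < e ∧ ENNReal.ofReal e ≤ ε / 2 := by
    obtain ⟨e, he, heε⟩ := ENNReal.lt_iff_exists_nnreal_btwn.1 (ENNReal.half_pos hε.ne')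
    exact ⟨e, by exact_mod_cast he, by rw [ENNReal.ofReal_coe_nnreal]; exact heε.le⟩
  have hexp : Real.exp γ < 2 := by
    rw [← Real.lt_log_iff_exp_lt (by norm_num)]; exact hγ2
  have hexp_pos := Real.exp_pos γ
  set q := Real.exp γ / 2 with hq
  have hq0 : 0 ≤ q := by positivity
  have hq1 : 0 < 1 - q := by linarith
  set D := |t 0 - t 1| with hD
  have hDpos : 0 < D := abs_pos.2 (sub_ne_zero.2 ht)
  have hlen : 0 < r₂ - r₁ := by linarith
  set K := 16 / (c * D * (r₂ - r₁)) with hK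
  have hKpos : 0 < K := by positivity
  -- The bound `c * D / 4` makes `s / 2 ^ n` small enough for `ratioLaw_close_le` at every level `k`;
  -- the last one makes the geometric series of the error probabilities at most `e`.
  set s := min 1 (min (c * D / 4) (e * (1 - q) / K)) with hs
  have hspos : 0 < s := by positivity
  have hs1 : s ≤ 1 := min_le_left _ _
  have hs2 : s ≤ c * D / 4 := (min_le_right _ _).trans (min_le_left _ _)
  have hs3 : s ≤ e * (1 - q) / K := (min_le_right _ _).trans (min_le_right _ _)
  refine ⟨s, hspos, hs1, fun n a => ?_⟩
  classical
  set u := extend b a with hu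
  -- The words of length `n` that share with `a` a prefix of length exactly `k`.
  set N : ℕ → Finset (Fin n → Fin 2) := fun k => Finset.univ.filter fun a' =>
    (∀ j < k, u.get j = (extend b a').get j) ∧ u.get k ≠ (extend b a').get k with hN
  set G : ℕ → (Fin n → Fin 2) → Set (Word → ℝ) := fun k a' => {r | r ∈ ratioBox r₁ r₂ ∧
    c * Real.exp (-γ * k) ≤ prefixProd r u k ∧
      |proj t r u - proj t r (extend b a')| ≤ s / 2 ^ n} with hG
  have hNcard : ∀ k, ((N k).card : ℝ) ≤ 2 ^ (n - k) := fun k => by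
    refine le_trans ?_ (b := (((2 ^ (n - k) : ℕ)) : ℝ)) (by simp)
    refine Nat.cast_le.2 ((Finset.card_le_card fun a' ha' => ?_).trans
      (card_filter_extend_eq_le b a k))
    exact Finset.mem_filter.2 ⟨Finset.mem_univ _, (Finset.mem_filter.1 ha').2.1⟩
  have hpow : ∀ k : ℕ, Real.exp (-γ * k) = ((Real.exp γ) ^ k)⁻¹ := fun k => by
    rw [← Real.exp_nat_mul, ← Real.exp_neg]; congr 1; ring
  have hGle : ∀ k < n, ∀ a' ∈ N k, ratioLaw r₁ r₂ (G k a')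
      ≤ ENNReal.ofReal (K * s / 2 ^ n * Real.exp γ ^ k) := by
    intro k hk a' ha'
    obtain ⟨hag, hne⟩ := (Finset.mem_filter.1 ha').2
    have hδ : s / 2 ^ n < c * Real.exp (-γ * k) * |t 0 - t 1| / 2 := by
      have h1 : Real.exp γ ^ k ≤ 2 ^ n :=
        (pow_le_pow_left₀ hexp_pos.le hexp.le k).trans (pow_le_pow_right₀ one_le_two hk.le)
      have h2 : s < c * D / 2 := hs2.trans_lt (by
        have : 0 < c * D := by positivity
        linarith)
      calc s / 2 ^ n ≤ s / Real.exp γ ^ k := by gcongr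
        _ < c * D / 2 / Real.exp γ ^ k := by gcongr
        _ = _ := by rw [hpow, hD]; field_simp
    refine (ratioLaw_close_le t ht h₀ h₁₂ h₂ hag hne (by positivity) (by positivity) hδ).trans
      (le_of_eq ?_)
    rw [hpow, hK, ← hD]
    congr 1
    field_simp
  have hsub : {r | ∃ a' : Fin n → Fin 2, a' ≠ a ∧
        |proj t r u - proj t r (extend b a')| ≤ s / 2 ^ n}
      ⊆ (ratioBox r₁ r₂)ᶜ ∪ ({r | ∃ k : ℕ, prefixProd r u k < c * Real.exp (-γ * k)} ∪
        ⋃ k ∈ Finset.range n, ⋃ a' ∈ N k, G k a') := by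
    rintro r ⟨a', hne, hclose⟩
    by_cases hbox : r ∈ ratioBox r₁ r₂
    · refine Or.inr ?_
      by_cases hdec : ∃ k : ℕ, prefixProd r u k < c * Real.exp (-γ * k)
      · exact Or.inl hdec
      · push Not at hdec
        obtain ⟨k, hkn, hag, hk⟩ := exists_first_difference b hne.symm
        refine Or.inr ?_
        simp only [mem_iUnion, exists_prop]
        exact ⟨k, Finset.mem_range.2 hkn, a', Finset.mem_filter.2 ⟨Finset.mem_univ _, hag, hk⟩,
          hbox, hdec k, hclose⟩
    · exact Or.inl hbox
  have hnull : ratioLaw r₁ r₂ (ratioBox r₁ r₂)ᶜ = 0 := ae_mem_ratioBox h₁₂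
  -- The ratios along `u` are independent, so the bound for sequences applies to each word alike.
  have hdecay : ratioLaw r₁ r₂ {r | ∃ k : ℕ, prefixProd r u k < c * Real.exp (-γ * k)} ≤ ε / 2 := by
    have hmp := measurePreserving_comp_infinitePi (uniformLaw r₁ r₂) (initialWord_injective u)
    have hm : MeasurableSet {x : ℕ → ℝ | ∃ k : ℕ,
        ∏ j ∈ Finset.range k, x j < c * Real.exp (-γ * k)} := by
      rw [ofPred_exists]
      exact MeasurableSet.iUnion fun k => measurableSet_lt (by fun_prop) measurable_const
    rw [← hmp.measure_preimage hm.nullMeasurableSet] at hcP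
    exact hcP
  have hclose : ratioLaw r₁ r₂ (⋃ k ∈ Finset.range n, ⋃ a' ∈ N k, G k a') ≤ ε / 2 := by
    calc ratioLaw r₁ r₂ (⋃ k ∈ Finset.range n, ⋃ a' ∈ N k, G k a')
        ≤ ∑ k ∈ Finset.range n, ratioLaw r₁ r₂ (⋃ a' ∈ N k, G k a') :=
          measure_biUnion_finset_le _ _
      _ ≤ ∑ k ∈ Finset.range n, ENNReal.ofReal (K * s * q ^ k) := by
          refine Finset.sum_le_sum fun k hk => ?_
          have hkn := Finset.mem_range.1 hk
          calc ratioLaw r₁ r₂ (⋃ a' ∈ N k, G k a') ≤ ∑ a' ∈ N k, ratioLaw r₁ r₂ (G k a') :=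
                measure_biUnion_finset_le _ _
            _ ≤ ∑ a' ∈ N k, ENNReal.ofReal (K * s / 2 ^ n * Real.exp γ ^ k) :=
                Finset.sum_le_sum fun a' ha' => hGle k hkn a' ha'
            _ = ENNReal.ofReal ((N k).card * (K * s / 2 ^ n * Real.exp γ ^ k)) := by
                rw [Finset.sum_const, nsmul_eq_mul, ENNReal.ofReal_mul (Nat.cast_nonneg _),
                  ENNReal.ofReal_natCast]
            _ ≤ ENNReal.ofReal (K * s * q ^ k) := by
                refine ENNReal.ofReal_le_ofReal ?_
                calc (N k).card * (K * s / 2 ^ n * Real.exp γ ^ k)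
                    ≤ 2 ^ (n - k) * (K * s / 2 ^ n * Real.exp γ ^ k) := by
                      gcongr; exact hNcard k
                  _ = K * s * q ^ k := by
                      obtain ⟨d, rfl⟩ := Nat.exists_eq_add_of_le hkn.le
                      rw [Nat.add_sub_cancel_left, pow_add, hq, div_pow]
                      field_simp
      _ = ENNReal.ofReal (K * s * ∑ k ∈ Finset.range n, q ^ k) := by
          rw [← ENNReal.ofReal_sum_of_nonneg fun k _ => by positivity, Finset.mul_sum]
      _ ≤ ENNReal.ofReal e := by
          refine ENNReal.ofReal_le_ofReal ?_
          have hgeo : ∑ k ∈ Finset.range n, q ^ k ≤ (1 - q)⁻¹ := by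
            rw [← tsum_geometric_of_lt_one hq0 (by linarith)]
            exact (summable_geometric_of_lt_one hq0 (by linarith)).sum_le_tsum _
              fun k _ => by positivity
          calc K * s * ∑ k ∈ Finset.range n, q ^ k
              ≤ K * (e * (1 - q) / K) * (1 - q)⁻¹ := by gcongr
            _ = e := by field_simp
      _ ≤ ε / 2 := heε
  calc _ ≤ _ := measure_mono hsub
    _ ≤ _ := measure_union_le _ _
    _ ≤ _ := add_le_add le_rfl (measure_union_le _ _)
    _ ≤ 0 + (ε / 2 + ε / 2) := add_le_add hnull.le (add_le_add hdecay hclose)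
    _ = ε := by rw [zero_add, ENNReal.add_halves]

/-! ### Positivity of the measure of the limsup set -/

/-- The event that some word `a' ≠ a` of the same length as `a` has `Π_r(a' b)` within `δ` of
`Π_r(a b)`. -/
def closeEvent (t : Fin 2 → ℝ) (b : Stream' (Fin 2)) (δ : ℝ) {n : ℕ} (a : Fin n → Fin 2) :
    Set (Word → ℝ) :=
  {r | ∃ a' : Fin n → Fin 2, a' ≠ a ∧ |proj t r (extend b a) - proj t r (extend b a')| ≤ δ}

theorem measurableSet_closeEvent (t : Fin 2 → ℝ) (b : Stream' (Fin 2)) (δ : ℝ) {n : ℕ}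
    (a : Fin n → Fin 2) : MeasurableSet (closeEvent t b δ a) := by
  have : closeEvent t b δ a = ⋃ a' : Fin n → Fin 2, ⋃ _ : a' ≠ a,
      {r | |proj t r (extend b a) - proj t r (extend b a')| ≤ δ} := by
    ext r; simp [closeEvent]
  rw [this]
  exact MeasurableSet.iUnion fun a' => MeasurableSet.iUnion fun _ =>
    measurableSet_le ((measurable_proj t _).sub (measurable_proj t _)).abs measurable_const

open Classical in
/-- The words `a` of length `n` such that no other word `a'` of length `n` has `Π_r(a' b)` within
`δ` of `Π_r(a b)`. -/
def isolatedWords (t : Fin 2 → ℝ) (b : Stream' (Fin 2)) (δ : ℝ) (n : ℕ) (r : Word → ℝ) :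
    Finset (Fin n → Fin 2) :=
  Finset.univ.filter fun a => r ∉ closeEvent t b δ a

/-- If at a fixed scale `s` at least half of the words are isolated, for a set of lengths carrying
a divergent part of the harmonic series, then the limsup set has positive measure. -/
theorem volume_limsupSet_pos_of_isolatedWords {t : Fin 2 → ℝ} {r₁ r₂ : ℝ} (h₀ : 0 ≤ r₁)
    (h₁₂ : r₁ < r₂) (h₂ : r₂ < 1) {r : Word → ℝ} (hr : r ∈ ratioBox r₁ r₂) (b : Stream' (Fin 2))
    {s : ℝ} (hs : 0 < s) (hs1 : s ≤ 1) {I : Set ℕ} (hI : ∀ n ∈ I, 1 ≤ n)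
    (hdiv : ¬ Summable (I.indicator fun n : ℕ => (1 / n : ℝ)))
    (hcard : ∀ n ∈ I, (2 : ℝ) ^ n / 2 ≤ (isolatedWords t b (s / 2 ^ n) n r).card) :
    0 < volume (limsupSet t r b) := by
  classical
  have hisol : ∀ n, ∀ a ∈ isolatedWords t b (s / 2 ^ n) n r, ∀ a' : Fin n → Fin 2, a' ≠ a →
      s / 2 ^ n < |proj t r (extend b a) - proj t r (extend b a')| := by
    intro n a ha a' hne
    by_contra! h
    exact (Finset.mem_filter.1 ha).2 ⟨a', hne, h⟩
  set C : ℕ → Finset ℝ := fun n =>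
    (isolatedWords t b (s / 2 ^ n) n r).image fun a => proj t r (extend b a) with hC
  have hCcard : ∀ n, (C n).card = (isolatedWords t b (s / 2 ^ n) n r).card := by
    refine fun n => Finset.card_image_of_injOn fun a ha a' _ heq => ?_
    by_contra hne
    have h := hisol n a ha a' (Ne.symm hne)
    have heq' : proj t r (extend b a) = proj t r (extend b a') := heq
    rw [heq', sub_self, abs_zero] at h
    exact absurd h (not_lt.2 (by positivity))
  refine (volume_infinitely_often_pos (R := (|t 0| + |t 1|) * (1 - r₂)⁻¹) hs (C := C) hI hdiv
    (fun n hn => by rw [hCcard]; exact hcard n hn) (fun n _ => ?_) (fun n _ => ?_)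
    (fun n _ => ?_)).trans_le (measure_mono fun x hx => ?_)
  · rw [hCcard]
    have : (isolatedWords t b (s / 2 ^ n) n r).card ≤ 2 ^ n :=
      (Finset.card_le_univ _).trans (by simp)
    exact_mod_cast this
  · intro p hp q hq hpq
    obtain ⟨a, ha, rfl⟩ := Finset.mem_image.1 hp
    obtain ⟨a', -, rfl⟩ := Finset.mem_image.1 hq
    exact hisol n a ha a' fun h => hpq (by rw [h])
  · intro p hp
    obtain ⟨a, -, rfl⟩ := Finset.mem_image.1 hp
    exact abs_proj_le h₀ h₁₂ h₂ hr _
  · -- The approximating words are infinitely many because their lengths are unbounded.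
    refine Set.Infinite.of_image (fun a : Word => a.1.length) (hx.mono ?_)
    rintro n ⟨hn, p, hp, hxp⟩
    obtain ⟨a, -, rfl⟩ := Finset.mem_image.1 hp
    have hn1 : 1 ≤ n := hI n hn
    have hn1' : (1 : ℝ) ≤ n := by exact_mod_cast hn1
    refine ⟨⟨List.ofFn a, fun h => ?_⟩, ?_, by simp⟩
    · have := congrArg List.length h
      simp at this
      omega
    · simp only [mem_ofPred_eq, List.length_ofFn]
      refine hxp.trans ?_
      rw [div_div]
      gcongr
      linarith

theorem ae_volume_limsupSet_pos (t : Fin 2 → ℝ) (ht : t 0 ≠ t 1) {r₁ r₂ : ℝ} (h₀ : 0 ≤ r₁)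
    (h₁₂ : r₁ < r₂) (h₂ : r₂ < 1)
    (hlog : Real.log 2 > -∫ x, Real.log x ∂(uniformLaw r₁ r₂)) (b : Stream' (Fin 2)) :
    ∀ᵐ r ∂(ratioLaw r₁ r₂), 0 < volume (limsupSet t r b) := by
  classical
  have := isProbabilityMeasure_ratioLaw h₁₂
  refine ae_iff.2 (le_antisymm (le_of_forall_pos_le_add fun ε hε => ?_) zero_le)
  rw [zero_add]
  obtain ⟨s, hs, hs1, hclose⟩ := exists_forall_ratioLaw_exists_close_le t ht h₀ h₁₂ h₂ hlog b
    (ENNReal.half_pos hε.ne')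
  -- Shifting the length by one leaves out the empty word and matches the harmonic series
  -- of `measure_tsum_indicator_ne_top_le`.
  set F : ℕ → Set (Word → ℝ) := fun n =>
    {r | (2 : ℝ) ^ (n + 1) / 2 ≤ (isolatedWords t b (s / 2 ^ (n + 1)) (n + 1) r).card} with hF
  have hFm : ∀ n, MeasurableSet (F n) := fun n =>
    measurableSet_le measurable_const
      (measurable_card_filter_notMem fun a => measurableSet_closeEvent t b _ a)
  have hFle : ∀ n, ratioLaw r₁ r₂ (F n)ᶜ ≤ ε := fun n => by
    have h := measure_card_filter_notMem_lt_le (P := ratioLaw r₁ r₂)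
      (fun a => measurableSet_closeEvent t b (s / 2 ^ (n + 1)) a) (fun a => hclose (n + 1) a)
    rw [ENNReal.mul_div_cancel (by simp) (by simp)] at h
    refine le_trans (measure_mono fun r hr => ?_) h
    have hr' : ¬ (2 : ℝ) ^ (n + 1) / 2
      ≤ (isolatedWords t b (s / 2 ^ (n + 1)) (n + 1) r).card := hr
    rw [mem_ofPred_eq]
    refine lt_of_eq_of_lt ?_ ((not_le.1 hr').trans_eq ?_)
    · unfold isolatedWords; congr
    · simp
  refine le_trans (measure_mono (t := (ratioBox r₁ r₂)ᶜ ∪ {r | ∑' n : ℕ,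
    (F n).indicator (fun _ => ((n : ENNReal) + 1)⁻¹) r ≠ ⊤}) fun r hr => ?_) ?_
  · by_contra hcon
    simp only [mem_union, mem_compl_iff, mem_ofPred_eq, not_or, not_not] at hcon
    obtain ⟨hbox, htop⟩ := hcon
    refine hr ?_
    set I : Set ℕ := {n | ∃ m, n = m + 1 ∧ r ∈ F m} with hIdef
    refine volume_limsupSet_pos_of_isolatedWords h₀ h₁₂ h₂ hbox b hs hs1 (I := I)
      (by rintro _ ⟨m, rfl, -⟩; omega) (fun hsum => ?_) (by rintro _ ⟨m, rfl, hm⟩; exact hm)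
    have hsum' := (summable_nat_add_iff 1).2 hsum
    refine hsum'.tsum_ofReal_ne_top ?_
    rw [← htop]
    refine tsum_congr fun n => ?_
    by_cases h : r ∈ F n
    · have hn : n + 1 ∈ I := ⟨n, rfl, h⟩
      rw [indicator_of_mem hn, indicator_of_mem h, one_div,
        ENNReal.ofReal_inv_of_pos (by positivity), ENNReal.ofReal_natCast]
      push_cast
      rfl
    · have hn : n + 1 ∉ I := by
        rintro ⟨m, hm, hm'⟩
        obtain rfl : n = m := by omega
        exact h hm'
      rw [indicator_of_notMem hn, indicator_of_notMem h, ENNReal.ofReal_zero]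
  · refine (measure_union_le _ _).trans ?_
    have hnull : ratioLaw r₁ r₂ (ratioBox r₁ r₂)ᶜ = 0 := ae_mem_ratioBox h₁₂
    rw [hnull, zero_add]
    exact measure_tsum_indicator_ne_top_le hFm hFle

end RandomIFS

end

theorem mainTheorem4 (t : Fin 2 → ℝ) (ht : t 0 ≠ t 1) (r₁ r₂ : ℝ) (h₀ : 0 ≤ r₁) (h₁₂ : r₁ < r₂)
    (h₂ : r₂ < 1) (hlog : Real.log 2 > -∫ x, Real.log x ∂(RandomIFS.uniformLaw r₁ r₂))
    (b : Stream' (Fin 2)) :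
    ∀ᵐ r ∂(RandomIFS.ratioLaw r₁ r₂), 0 < volume (RandomIFS.limsupSet t r b) :=
  RandomIFS.ae_volume_limsupSet_pos t ht h₀ h₁₂ h₂ hlog b
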